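/- Let $N\in\mathbb N$, $L>1$, $\nu_1,\dots,\nu_N\in\mathbb R^2$, $\Psi_i(x)=x/L+\nu_i$, and let $\mathcal K$ be the unique nonempty compact subset of $\mathbb R^2$ with $\mathcal K=\bigcup_{i=1}^N\Psi_i(\mathcal K)$. Let $V_0$ be the set of essential fixed points, i.e. of those fixed points $x$ of the maps $\Psi_1,\dots,\Psi_N$ for which there are another fixed point $y$ of one of these maps and two different maps $\Psi_i,\Psi_j$ with $\Psi_i(x)=\Psi_j(y)$; put $k=\#V_0$. Suppose that $\mathcal K$ is a simple nested fractal, i.e. (1) $k\ge 2$; (2) there is a nonempty open set $U\subset\mathbb R^2$ with $\Psi_i(U)\cap\Psi_j(U)=\emptyset$ for $i\ne j$ and $\bigcup_i\Psi_i(U)\subseteq U$; (3) $\Psi_i(\mathcal K)\cap\Psi_j(\mathcal K)=\Psi_i(V_0)\cap\Psi_j(V_0)$ for $i\neq j$; (4) for all distinct $x,y\in V_0$, the reflection $S_{x,y}$ in the perpendicular bisector of $[x,y]$ satisfies: for every $i$ there is $j$ with $S_{x,y}(\Psi_i(V_0))=\Psi_j(V_0)$; (5) the graph on $\bigcup_i\Psi_i(V_0)$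 in which two distinct points are joined if and only if both lie in $\Psi_i(\mathcal K)$ for some $i$ is connected. Normalise coordinates so that $0$ is a fixed point of one of the maps, i.e. $\nu_i=0$ for some $i$. For $M\in\mathbb Z$ put $\mathcal K^{\langle M\rangle}=L^M\mathcal K$ and $V_M^{\langle M\rangle}=L^MV_0$, and let $\mathcal K^{\langle\infty\rangle}=\bigcup_{M\ge0}\mathcal K^{\langle M\rangle}$ be the unbounded fractal. An $M$-complex is a set $\Delta=\mathcal K^{\langle M\rangle}+\nu_\Delta\subset\mathcal K^{\langle\infty\rangle}$ with $\nu_\Delta=\sum_{j=M+1}^{J}L^j\nu_{i_j}$ for some $J\ge M+1$ and $i_j\in\{1,\dots,N\}$; its vertices are the points of $V(\Delta)=V_M^{\langle M\rangle}+\nu_\Delta$. Let $V_0^{\langle0\rangle}=V_0$, $V_0^{\langle m+1\rangle}=\bigcup_{i=1}^N\bigl(V_0^{\langle m\rangle}+L^{m+1}\nu_i\bigr)$ for $m\ge 0$, and $V_M^{\langle\infty\rangle}=L^M\bigcup_{m\ge0}V_0^{\langle m\rangle}$. The unbounded fractal $\mathcal K^{\langle\infty\rangle}$ has the good labelling property (GLP)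 if for some $M\in\mathbb Z$ there is a map $\ell:V_M^{\langle\infty\rangle}\to\mathcal A$ into an alphabet $\mathcal A$ of $k$ symbols such that $\ell$ restricted to $V_M^{\langle M\rangle}$ is a bijection onto $\mathcal A$, and for every $M$-complex $\Delta=\mathcal K^{\langle M\rangle}+\nu_\Delta$ there is a rotation $R$ around the barycenter of $\mathcal K^{\langle M\rangle}$ by an angle $2\pi r/k$, $r\in\{1,\dots,k\}$, with $\ell(v)=\ell(R(v-\nu_\Delta))$ for all $v\in V(\Delta)$. Theorem. If $k=2^n$ with $n\in\mathbb N$, $n>1$, then $\mathcal K^{\langle\infty\rangle}$ has the GLP. -/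

import Mathlib

noncomputable section

/-- A finite system of similitudes `Ψ i (x) = x / L + ν i` of the Euclidean plane (written as `ℂ`)
with common scaling factor `L > 1`. -/
structure SimilitudeSystem where
  N : ℕ
  L : ℝ
  one_lt_L : 1 < L
  ν : Fin N → ℂ

namespace SimilitudeSystem

/-- The similitude `Ψ i`. -/
def Ψ (S : SimilitudeSystem) (i : Fin S.N) (x : ℂ) : ℂ := S.L⁻¹ • x + S.ν i

/-- The set `F` of all fixed points of the similitudes. -/
def fixedPts (S : SimilitudeSystem) : Set ℂ := {x | ∃ i, S.Ψ i x = x}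

/-- The set `V₀^⟨0⟩` of essential fixed points. -/
def essential (S : SimilitudeSystem) : Set ℂ :=
  {x | x ∈ S.fixedPts ∧
    ∃ y ∈ S.fixedPts, y ≠ x ∧ ∃ i j : Fin S.N, S.Ψ i ≠ S.Ψ j ∧ S.Ψ i x = S.Ψ j y}

/-- The number `k` of essential fixed points (`essential` is always a finite set). -/
def k (S : SimilitudeSystem) : ℕ := S.essential.ncard

/-- `K` is the fractal generated by the system: the nonempty compact set with `K = ⋃ i, Ψ i (K)`. -/
structure IsAttractor (S : SimilitudeSystem) (K : Set ℂ) : Prop where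
  nonempty : K.Nonempty
  isCompact : IsCompact K
  eq_iUnion : K = ⋃ i, S.Ψ i '' K

/-- The set `V₋₁^⟨0⟩ = ⋃ i, Ψ i (V₀^⟨0⟩)`. -/
def firstVertices (S : SimilitudeSystem) : Set ℂ := ⋃ i, S.Ψ i '' S.essential

/-- The graph on `V₋₁^⟨0⟩` joining two points that lie in a common `Ψ i (K)`. -/
def cellGraph (S : SimilitudeSystem) (K : Set ℂ) : SimpleGraph S.firstVertices where
  Adj x y := x ≠ y ∧ ∃ i, (x : ℂ) ∈ S.Ψ i '' K ∧ (y : ℂ) ∈ S.Ψ i '' K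
  symm := ⟨fun _ _ h => ⟨h.1.symm, h.2.imp fun _ hi => ⟨hi.2, hi.1⟩⟩⟩
  loopless := ⟨fun _ h => h.1 rfl⟩

/-- The reflection `S_{x,y}` in the line bisecting the segment `[x, y]` perpendicularly. -/
def bisectorReflection (x y : ℂ) : ℂ → ℂ :=
  haveI : Nonempty (AffineSubspace.perpBisector x y) :=
    AffineSubspace.perpBisector_nonempty.to_subtype
  EuclideanGeometry.reflection (AffineSubspace.perpBisector x y)

/-- `K` is the simple nested fractal generated by the system `S`. -/
structure IsSimpleNestedFractal (S : SimilitudeSystem) (K : Set ℂ) : Prop where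
  isAttractor : S.IsAttractor K
  two_le : 2 ≤ S.k
  openSet : ∃ U : Set ℂ, IsOpen U ∧ U.Nonempty ∧
    (∀ i j, i ≠ j → S.Ψ i '' U ∩ S.Ψ j '' U = ∅) ∧ (⋃ i, S.Ψ i '' U) ⊆ U
  nesting : ∀ i j, i ≠ j →
    S.Ψ i '' K ∩ S.Ψ j '' K = S.Ψ i '' S.essential ∩ S.Ψ j '' S.essential
  symmetry : ∀ i, ∀ x ∈ S.essential, ∀ y ∈ S.essential, x ≠ y →
    ∃ j, bisectorReflection x y '' (S.Ψ i '' S.essential) = S.Ψ j '' S.essential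
  connected : (S.cellGraph K).Connected

/-- `K^⟨M⟩ = L^M K`. -/
def blowup (S : SimilitudeSystem) (K : Set ℂ) (M : ℤ) : Set ℂ := (fun x => S.L ^ M • x) '' K

/-- The unbounded fractal `K^⟨∞⟩ = ⋃ M ≥ 0, K^⟨M⟩`. -/
def unbounded (S : SimilitudeSystem) (K : Set ℂ) : Set ℂ := ⋃ M : ℕ, S.blowup K M

/-- `t` is of the form `∑_{j=M+1}^{J} L^j ν_{i_j}` with `J ≥ M + 1`. -/
def IsOffset (S : SimilitudeSystem) (M : ℤ) (t : ℂ) : Prop :=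
  ∃ J : ℤ, M + 1 ≤ J ∧ ∃ i : ℤ → Fin S.N, t = ∑ j ∈ Finset.Icc (M + 1) J, S.L ^ j • S.ν (i j)

/-- `Δ = K^⟨M⟩ + t` is an `M`-complex, represented with the translation vector `t`. -/
def IsComplex (S : SimilitudeSystem) (K : Set ℂ) (M : ℤ) (Δ : Set ℂ) (t : ℂ) : Prop :=
  Δ ⊆ S.unbounded K ∧ S.IsOffset M t ∧ Δ = (fun x => x + t) '' S.blowup K M

/-- `V_M^⟨M⟩ = L^M V₀^⟨0⟩`, the vertices of `K^⟨M⟩`. -/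
def vertices (S : SimilitudeSystem) (M : ℤ) : Set ℂ := (fun x => S.L ^ M • x) '' S.essential

/-- The vertices of an `M`-complex with translation vector `t`. -/
def complexVertices (S : SimilitudeSystem) (M : ℤ) (t : ℂ) : Set ℂ :=
  (fun x => x + t) '' S.vertices M

/-- `V₀^⟨m⟩`, the vertices of all `0`-complexes inside `K^⟨m⟩`. Since
`K^⟨m+1⟩ = ⋃ i, (K^⟨m⟩ + L^(m+1) ν_i)`, the `m`-complexes of `K^⟨m+1⟩` have
translation vectors `L^(m+1) ν_i`. -/
def zeroVertices (S : SimilitudeSystem) : ℕ → Set ℂ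
  | 0 => S.vertices 0
  | m + 1 => ⋃ i, (fun x => x + S.L ^ (m + 1) • S.ν i) '' S.zeroVertices m

/-- `V_M^⟨∞⟩ = L^M V₀^⟨∞⟩` with `V₀^⟨∞⟩ = ⋃ m, V₀^⟨m⟩`. -/
def unboundedVertices (S : SimilitudeSystem) (M : ℤ) : Set ℂ :=
  (fun x => S.L ^ M • x) '' ⋃ m : ℕ, S.zeroVertices m

/-- The barycenter of `K^⟨M⟩`, i.e. of its vertices. -/
def barycenter (S : SimilitudeSystem) (M : ℤ) : ℂ := (S.k : ℂ)⁻¹ * ∑ᶠ v ∈ S.vertices M, v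

/-- The rotation by the angle `2πr/k` around the barycenter of `K^⟨M⟩`. -/
def rotation (S : SimilitudeSystem) (M : ℤ) (r : ℕ) (x : ℂ) : ℂ :=
  S.barycenter M +
    Complex.exp (2 * Real.pi * Complex.I * (r / S.k)) * (x - S.barycenter M)

/-- `l : V_M^⟨∞⟩ → {labels}` is a good labelling function of order `M`; the `k` labels are the
elements of `Fin k`. -/
structure IsGoodLabelling (S : SimilitudeSystem) (K : Set ℂ) (M : ℤ)
    (l : S.unboundedVertices M → Fin S.k) : Prop where
  /-- The restriction of `l` to `V_M^⟨M⟩` is a bijection onto the alphabet. -/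
  bijOn : Set.BijOn l {v | (v : ℂ) ∈ S.vertices M} Set.univ
  /-- On each `M`-complex, `l` is a rotated copy of the labelling of `V_M^⟨M⟩`. -/
  rotated : ∀ Δ t, S.IsComplex K M Δ t → ∃ r ∈ Finset.Icc 1 S.k,
    ∀ v ∈ S.complexVertices M t,
      ∃ (hv : v ∈ S.unboundedVertices M) (hr : S.rotation M r (v - t) ∈ S.unboundedVertices M),
        l ⟨v, hv⟩ = l ⟨S.rotation M r (v - t), hr⟩

/-- The good labelling property of the unbounded fractal `K^⟨∞⟩`. -/
def HasGLP (S : SimilitudeSystem) (K : Set ℂ) : Prop :=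
  ∃ M : ℤ, ∃ l : S.unboundedVertices M → Fin S.k, S.IsGoodLabelling K M l

end SimilitudeSystem

end

/-!
All cells are translates of each other, so a good labelling amounts to a rotation index in `ℤ/k`
for each cell, with neighbouring cells agreeing at their common vertices.

*Shape of a cell.* Each reflection `S_{x,y}` permutes the vertex sets of the `1`-cells, hence fixes
the mean of all their vertices; so the essential fixed points lie on a circle. Since the image of
this set under `S_{x,y}` is one of its translates, it is preserved by `S_{x,y}`. After normalisation
it is a finite set of unit complex numbers closed under `(x, y, z) ↦ x y z̄`, that is, the group of
`k`-th roots of unity: the essential fixed points are `c + w ζ ^ a`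
(`IsSimpleNestedFractal.essential_eq_range`).

*Neighbouring cells.* Two cells share at most one vertex: if they shared `p` and `q`, both would
contain the non-vertex `p + (q - p) / L`, contrary to nesting
(`IsSimpleNestedFractal.shared_vertex_unique`). As `k` is even, the cells are centrally symmetric,
so a shared vertex comes with its mirror image in the midpoint of the two centres. Hence
neighbouring cells differ by a diagonal `2 w ζ ^ a`, and by connectedness all offsets of
`0`-complexes lie in the lattice `2 w ℤ[ζ]` (`IsSimpleNestedFractal.isOffset_mem`).

*Parity.* For `k = 2 ^ (m + 1)` the cyclotomic polynomial `X ^ 2 ^ m + 1` takes the value `2` at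
`1`, so `P(ζ) ↦ P(1)` is a well-defined parity on `ℤ[ζ]`, odd on each diagonal step. The vertex
`c + w (ζ ^ a + 2 P(ζ))` receives the label `a + (k / 2) P(1)` modulo `k`. It depends only on the
vertex (`label_eq_of_aeval_eq`), because powers of `ζ` congruent modulo `2` agree up to sign, and
`-1 = ζ ^ (k / 2)` is odd. On the complex with offset `2 w P(ζ)` it is the original labelling,
rotated by `(k / 2) P(1)` steps.
-/

open Polynomial ComplexConjugate

namespace SimilitudeSystem

/-! ### Finite sets closed under reflections in perpendicular bisectors -/

theorem bisectorReflection_apply {x y : ℂ} (hxy : x ≠ y) (z : ℂ) :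
    bisectorReflection x y z =
      (x + y) / 2 - (y - x) / conj (y - x) * conj (z - (x + y) / 2) := by
  have : Nonempty (AffineSubspace.perpBisector x y) :=
    AffineSubspace.perpBisector_nonempty.to_subtype
  set e : ℂ := y - x with he
  have he0 : e ≠ 0 := sub_ne_zero.mpr hxy.symm
  have hce0 : conj e ≠ 0 := by simpa using he0
  -- `α • e` is the component of `z` perpendicular to the bisector
  set α : ℝ := ((z - (x + y) / 2) * conj e).re / Complex.normSq e with hα
  have hαC : (α : ℂ) * (2 * (e * conj e)) =
      (z - (x + y) / 2) * conj e + conj (z - (x + y) / 2) * e := by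
    have h1 : ((Complex.normSq e : ℝ) : ℂ) ≠ 0 := by
      exact_mod_cast (Complex.normSq_pos.mpr he0).ne'
    rw [hα, Complex.ofReal_div, Complex.mul_conj, Complex.re_eq_add_conj, map_mul,
      Complex.conj_conj]
    field_simp
  have hmid : midpoint ℝ x y = (x + y) / 2 := by
    rw [midpoint_eq_smul_add, Complex.real_smul]
    simp
    ring
  have hp : z - α • e ∈ AffineSubspace.perpBisector x y := by
    rw [AffineSubspace.mem_perpBisector_iff_inner_eq_zero, hmid, vsub_eq_sub, vsub_eq_sub, ← he,
      real_inner_comm, Complex.inner]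
    have h2 : (z - α • e - (x + y) / 2) * conj e
        = (z - (x + y) / 2) * conj e - ((α * Complex.normSq e : ℝ) : ℂ) := by
      rw [Complex.real_smul]
      push_cast
      rw [← Complex.mul_conj]
      ring
    rw [h2, Complex.sub_re, Complex.ofReal_re, hα, div_mul_cancel₀, sub_self]
    exact (Complex.normSq_pos.mpr he0).ne'
  have hv : α • e ∈ (AffineSubspace.perpBisector x y).directionᗮ := by
    rw [AffineSubspace.direction_perpBisector, Submodule.orthogonal_orthogonal]
    exact Submodule.smul_mem _ _ (Submodule.mem_span_singleton_self _)
  have h := EuclideanGeometry.reflection_orthogonal_vadd hp hv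
  simp only [vadd_eq_add, add_sub_cancel] at h
  change EuclideanGeometry.reflection (AffineSubspace.perpBisector x y) z = _
  rw [h, Complex.real_smul, ← sub_eq_zero]
  refine (mul_eq_zero.mp (?_ : _ * conj e = 0)).resolve_right hce0
  have h3 : e / conj e * conj (z - (x + y) / 2) * conj e = e * conj (z - (x + y) / 2) := by
    field_simp
  linear_combination (-1) * hαC + h3

theorem bisectorReflection_left {x y : ℂ} (hxy : x ≠ y) : bisectorReflection x y x = y := by
  have : conj (y - x) ≠ 0 := (_root_.map_ne_zero _).mpr (sub_ne_zero.mpr hxy.symm)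
  rw [bisectorReflection_apply hxy, show x - (x + y) / 2 = -(y - x) / 2 by ring]
  simp only [map_div₀, map_neg, Complex.conj_ofNat]
  field_simp
  ring

theorem dist_bisectorReflection (x y z w : ℂ) :
    dist (bisectorReflection x y z) (bisectorReflection x y w) = dist z w := by
  have : Nonempty (AffineSubspace.perpBisector x y) :=
    AffineSubspace.perpBisector_nonempty.to_subtype
  exact (EuclideanGeometry.reflection (AffineSubspace.perpBisector x y)).dist_map z w

theorem bisectorReflection_injective (x y : ℂ) : Function.Injective (bisectorReflection x y) :=
  fun z w h => dist_eq_zero.mp (by rw [← dist_bisectorReflection x y, h, dist_self])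

/-- A finite set of unit complex numbers that contains `1` and is closed under the reflections
`z ↦ x y z̄` exchanging two of its points consists of roots of unity. Once it has three elements,
it is a multiplicative group. -/
theorem pow_card_eq_one_of_reflections (W : Finset ℂ) (h3 : 3 ≤ W.card) (h1 : 1 ∈ W)
    (hunit : ∀ z ∈ W, z * conj z = 1)
    (hW : ∀ x ∈ W, ∀ y ∈ W, ∀ z ∈ W, x ≠ y → x * y * conj z ∈ W) :
    ∀ z ∈ W, z ^ W.card = 1 := by
  have hinv : ∀ z ∈ W, conj z ∈ W := by
    intro z hz
    by_cases hz1 : z = 1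
    · simpa [hz1] using h1
    -- The reflection exchanging `1` and `1` is not available, so pass through a third point.
    obtain ⟨w, hw, hw'⟩ : ∃ w ∈ W, w ∉ ({1, z} : Finset ℂ) := by
      by_contra! hsub
      have := Finset.card_le_card (show W ⊆ {1, z} from hsub)
      have := Finset.card_le_two (a := (1 : ℂ)) (b := z)
      omega
    simp only [Finset.mem_insert, Finset.mem_singleton, not_or] at hw'
    have hwz : w * 1 * conj z ∈ W := hW w hw 1 h1 z hz hw'.1
    have hne : w * 1 * conj z ≠ 1 := by
      intro h
      apply hw'.2
      linear_combination z * h - w * hunit z hz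
    have := hW _ hwz 1 h1 w hw hne
    rwa [show w * 1 * conj z * 1 * conj w = conj z by
      linear_combination conj z * hunit w hw] at this
  have hmul : ∀ x ∈ W, ∀ z ∈ W, z * x ∈ W := by
    intro x hx z hz
    by_cases hz1 : z = 1
    · simpa [hz1] using hx
    have := hW z hz 1 h1 _ (hinv x hx) hz1
    simpa using this
  intro z hz
  have hz0 : z ≠ 0 := by
    rintro rfl
    simpa using hunit 0 hz
  have himg : W.image (z * ·) = W := by
    apply Finset.eq_of_subset_of_card_le
    · intro x hx
      obtain ⟨y, hy, rfl⟩ := Finset.mem_image.mp hx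
      exact hmul y hy z hz
    · rw [Finset.card_image_of_injective _ (mul_right_injective₀ hz0)]
  have hprod : ∏ x ∈ W, x = z ^ W.card * ∏ x ∈ W, x := by
    conv_lhs => rw [← himg]
    rw [Finset.prod_image (fun a _ b _ h => mul_right_injective₀ hz0 h),
      Finset.prod_mul_distrib, Finset.prod_const]
  have hne : ∏ x ∈ W, x ≠ 0 := by
    rw [Finset.prod_ne_zero_iff]
    rintro x hx rfl
    simpa using hunit 0 hx
  exact (mul_eq_right₀ hne).mp hprod.symm

theorem dist_eq_of_common_fixedPoint {V : Set ℂ} {c : ℂ}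
    (hc : ∀ x ∈ V, ∀ y ∈ V, x ≠ y → bisectorReflection x y c = c)
    {x y : ℂ} (hx : x ∈ V) (hy : y ∈ V) : dist x c = dist y c := by
  by_cases hxy : x = y
  · rw [hxy]
  · rw [← dist_bisectorReflection x y x c, bisectorReflection_left hxy, hc x hx y hy hxy]

/-- A finite set of `k ≥ 3` points that is invariant under all reflections exchanging two of its
points, with a common fixed point `c` of these reflections, is the vertex set of a regular
`k`-gon with centre `c`. -/
theorem eq_range_of_bisectorReflection {V : Set ℂ} (hV : V.Finite) (h3 : 3 ≤ V.ncard) {c : ℂ}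
    (hc : ∀ x ∈ V, ∀ y ∈ V, x ≠ y → bisectorReflection x y c = c)
    (hinv : ∀ x ∈ V, ∀ y ∈ V, x ≠ y → ∀ z ∈ V, bisectorReflection x y z ∈ V)
    {ζ : ℂ} (hζ : IsPrimitiveRoot ζ V.ncard) :
    ∃ w : ℂ, w ≠ 0 ∧ V = Set.range fun a : ℕ => c + w * ζ ^ a := by
  have hdist : ∀ x ∈ V, ∀ y ∈ V, dist x c = dist y c := fun x hx y hy =>
    dist_eq_of_common_fixedPoint hc hx hy
  obtain ⟨x₀, hx₀, y₀, hy₀, -, -, hne, -, -⟩ := (Set.two_lt_ncard hV).mp h3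
  set w : ℂ := x₀ - c with hw
  have hw0 : w ≠ 0 := by
    intro h
    have hx : dist x₀ c = 0 := dist_eq_zero.mpr (sub_eq_zero.mp h)
    have hy : dist y₀ c = 0 := by rw [← hdist x₀ hx₀ y₀ hy₀, hx]
    exact hne ((dist_eq_zero.mp hx).trans (dist_eq_zero.mp hy).symm)
  have hcw0 : conj w ≠ 0 := by simpa using hw0
  set f : ℂ → ℂ := fun z => (z - c) / w with hf
  have hfinj : Function.Injective f := fun a b h => by
    have : a - c = b - c := (div_left_inj' hw0).mp h
    linear_combination this
  have hfc : ∀ z, z = c + w * f z := fun z => by simp only [hf]; field_simp; ring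
  set W : Finset ℂ := hV.toFinset.image f with hWdef
  have hcard : W.card = V.ncard := by
    rw [hWdef, Finset.card_image_of_injective _ hfinj, Set.ncard_eq_toFinset_card V hV]
  have hmem : ∀ z, z ∈ W ↔ c + w * z ∈ V := by
    intro z
    simp only [hWdef, Finset.mem_image, Set.Finite.mem_toFinset]
    constructor
    · rintro ⟨a, ha, rfl⟩
      rwa [← hfc]
    · intro h
      exact ⟨_, h, by simp only [hf]; field_simp; ring⟩
  have hunit : ∀ z ∈ W, z * conj z = 1 := by
    intro z hz
    have h := hdist _ ((hmem z).mp hz) _ hx₀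
    rw [dist_eq_norm, dist_eq_norm, add_sub_cancel_left, norm_mul, ← hw] at h
    have hz1 : ‖z‖ = 1 := by
      have : ‖w‖ ≠ 0 := norm_ne_zero_iff.mpr hw0
      exact (mul_eq_left₀ this).mp h
    rw [Complex.mul_conj, Complex.normSq_eq_norm_sq, hz1]
    simp
  have h1 : (1 : ℂ) ∈ W := (hmem 1).mpr (by simpa [hw] using hx₀)
  have hcl : ∀ x ∈ W, ∀ y ∈ W, ∀ z ∈ W, x ≠ y → x * y * conj z ∈ W := by
    intro x hx y hy z hz hxy
    have hne' : c + w * x ≠ c + w * y := fun h =>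
      hxy (mul_left_cancel₀ hw0 (add_left_cancel h))
    have hR := hinv _ ((hmem x).mp hx) _ ((hmem y).mp hy) hne' _ ((hmem z).mp hz)
    have hRc := hc _ ((hmem x).mp hx) _ ((hmem y).mp hy) hne'
    rw [bisectorReflection_apply hne'] at hR hRc
    rw [hmem]
    convert hR using 1
    have hd : conj (y - x) ≠ 0 := (_root_.map_ne_zero _).mpr (sub_ne_zero.mpr hxy.symm)
    have hquot : (c + w * y - (c + w * x)) / conj (c + w * y - (c + w * x)) * conj w =
        -(w * (x * y)) := by
      rw [show c + w * y - (c + w * x) = w * (y - x) by ring, map_mul]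
      field_simp
      rw [map_sub]
      linear_combination x * hunit y hy - y * hunit x hx
    have hsplit : conj (c + w * z - (c + w * x + (c + w * y)) / 2) =
        conj w * conj z + conj (c - (c + w * x + (c + w * y)) / 2) := by
      rw [← map_mul, ← map_add]
      congr 1
      ring
    rw [hsplit]
    linear_combination (-1 : ℂ) * hRc + conj z * hquot
  have hpow := pow_card_eq_one_of_reflections W (hcard ▸ h3) h1 hunit hcl
  have hk : 0 < V.ncard := by omega
  have hWeq : W = nthRootsFinset V.ncard (1 : ℂ) := by
    apply Finset.eq_of_subset_of_card_le
    · intro z hz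
      rw [mem_nthRootsFinset hk, ← hcard]
      exact hpow z hz
    · rw [hζ.card_nthRootsFinset, hcard]
  refine ⟨w, hw0, Set.ext fun z => ⟨fun hz => ?_, ?_⟩⟩
  · have hfz : f z ∈ W := (hmem _).mpr (by rwa [← hfc])
    rw [hWeq, mem_nthRootsFinset hk] at hfz
    have : NeZero V.ncard := ⟨hk.ne'⟩
    obtain ⟨a, -, ha⟩ := hζ.eq_pow_of_pow_eq_one hfz
    exact ⟨a, by rw [hfc z, ← ha]⟩
  · rintro ⟨a, rfl⟩
    rw [← hmem, hWeq, mem_nthRootsFinset hk, ← pow_mul, mul_comm, pow_mul, hζ.pow_eq_one, one_pow]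

/-! ### The essential fixed points of a simple nested fractal -/

theorem Ψ_apply (S : SimilitudeSystem) (i : Fin S.N) (x : ℂ) :
    S.Ψ i x = (S.L : ℂ)⁻¹ * x + S.ν i := by
  simp [Ψ]

theorem L_ne_zero (S : SimilitudeSystem) : (S.L : ℂ) ≠ 0 := by
  exact_mod_cast (zero_lt_one.trans S.one_lt_L).ne'

theorem Ψ_injective (S : SimilitudeSystem) (i : Fin S.N) : Function.Injective (S.Ψ i) := by
  intro x y h
  rw [Ψ_apply, Ψ_apply] at h
  exact mul_left_cancel₀ (inv_ne_zero S.L_ne_zero) (add_right_cancel h)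

theorem fixedPts_subset {S : SimilitudeSystem} {K : Set ℂ} (hK : S.IsAttractor K) :
    S.fixedPts ⊆ K := by
  rintro x ⟨i, hx⟩
  obtain ⟨z, hz⟩ := hK.nonempty
  have hmaps : ∀ y ∈ K, S.Ψ i y ∈ K := fun y hy => by
    rw [hK.eq_iUnion]
    exact Set.mem_iUnion.mpr ⟨i, y, hy, rfl⟩
  have hsub : ∀ y, S.Ψ i y - x = (S.L : ℂ)⁻¹ * (y - x) := fun y => by
    conv_lhs => rw [← hx]
    rw [Ψ_apply, Ψ_apply]
    ring
  have hiter : ∀ n : ℕ, x + (S.L : ℂ)⁻¹ ^ n * (z - x) ∈ K := by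
    intro n
    induction n with
    | zero => simpa using hz
    | succ n ih =>
      convert hmaps _ ih using 1
      linear_combination -hsub (x + (S.L : ℂ)⁻¹ ^ n * (z - x))
  have hlim : Filter.Tendsto (fun n : ℕ => x + (S.L : ℂ)⁻¹ ^ n * (z - x)) Filter.atTop (nhds x) := by
    have h0 : Filter.Tendsto (fun n : ℕ => (S.L : ℂ)⁻¹ ^ n) Filter.atTop (nhds 0) := by
      apply tendsto_pow_atTop_nhds_zero_of_norm_lt_one
      rw [norm_inv, Complex.norm_real, Real.norm_of_nonneg (zero_lt_one.trans S.one_lt_L).le]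
      exact inv_lt_one_of_one_lt₀ S.one_lt_L
    simpa using (h0.mul_const (z - x)).const_add x
  exact hK.isCompact.isClosed.mem_of_tendsto hlim (Filter.Eventually.of_forall hiter)

theorem essential_subset {S : SimilitudeSystem} {K : Set ℂ} (hK : S.IsAttractor K) :
    S.essential ⊆ K :=
  fun _ hx => fixedPts_subset hK hx.1

namespace IsSimpleNestedFractal

variable {S : SimilitudeSystem} {K : Set ℂ}

theorem finite_essential (hK : S.IsSimpleNestedFractal K) : S.essential.Finite :=
  Set.finite_of_ncard_ne_zero (by have : 2 ≤ S.essential.ncard := hK.two_le; omega)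

theorem nonempty_essential (hK : S.IsSimpleNestedFractal K) : S.essential.Nonempty :=
  Set.nonempty_of_ncard_ne_zero (by have : 2 ≤ S.essential.ncard := hK.two_le; omega)

theorem N_ne_zero (hK : S.IsSimpleNestedFractal K) : S.N ≠ 0 := by
  obtain ⟨x, ⟨i, -⟩, -⟩ := hK.nonempty_essential
  exact (Fin.pos i).ne'

/-- By the open set condition, the translation vectors are pairwise distinct. -/
theorem ν_injective (hK : S.IsSimpleNestedFractal K) : Function.Injective S.ν := by
  intro i j h
  obtain ⟨U, -, ⟨u, hu⟩, hdisj, -⟩ := hK.openSet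
  by_contra hij
  have hmem : S.Ψ i u ∈ S.Ψ i '' U ∩ S.Ψ j '' U :=
    ⟨⟨u, hu, rfl⟩, ⟨u, hu, by rw [Ψ_apply, Ψ_apply, h]⟩⟩
  rw [hdisj i j hij] at hmem
  exact hmem

theorem sum_eq_of_image_eq {V : Set ℂ} (hV : V.Finite) {f g : ℂ → ℂ} (hf : Function.Injective f)
    (hg : Function.Injective g) (h : f '' V = g '' V) :
    ∑ v ∈ hV.toFinset, f v = ∑ v ∈ hV.toFinset, g v := by
  classical
  have himg : hV.toFinset.image f = hV.toFinset.image g := by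
    apply Finset.coe_injective
    simpa using h
  rw [← Finset.sum_image (f := fun z : ℂ => z) fun a _ b _ hab => hf hab, himg,
    Finset.sum_image fun a _ b _ hab => hg hab]

theorem eq_of_image_essential_eq (hK : S.IsSimpleNestedFractal K) {i j : Fin S.N}
    (h : S.Ψ i '' S.essential = S.Ψ j '' S.essential) : i = j := by
  apply hK.ν_injective
  have hsum := sum_eq_of_image_eq hK.finite_essential (S.Ψ_injective i) (S.Ψ_injective j) h
  simp only [Ψ_apply, Finset.sum_add_distrib, Finset.sum_const, nsmul_eq_mul] at hsum
  have hcard : (hK.finite_essential.toFinset.card : ℂ) ≠ 0 := by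
    have := hK.nonempty_essential
    simpa [Set.nonempty_iff_ne_empty] using this
  exact mul_left_cancel₀ hcard (add_left_cancel hsum)

/-- The reflections of the symmetry condition have a common fixed point: each of them permutes the
vertex sets of the `1`-cells, hence fixes the mean of all vertices of all `1`-cells. -/
theorem exists_common_fixedPoint (hK : S.IsSimpleNestedFractal K) :
    ∃ c : ℂ, ∀ x ∈ S.essential, ∀ y ∈ S.essential, x ≠ y → bisectorReflection x y c = c := by
  have hfin := hK.finite_essential
  set F : Finset ℂ := hfin.toFinset with hF
  have hF0 : (F.card : ℂ) ≠ 0 := by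
    have := hK.nonempty_essential
    simpa [hF, Set.nonempty_iff_ne_empty] using this
  have hN0 : (S.N : ℂ) ≠ 0 := by exact_mod_cast hK.N_ne_zero
  set T : ℂ := ∑ i, ∑ v ∈ F, S.Ψ i v with hT
  refine ⟨T / (S.N * F.card), fun x hx y hy hxy => ?_⟩
  choose σ hσ using fun i => hK.symmetry i x hx y hy hxy
  have hσinj : Function.Injective σ := by
    intro i j hij
    apply hK.eq_of_image_essential_eq
    apply (bisectorReflection_injective x y).image_injective
    rw [hσ, hσ, hij]
  set u : ℂ := -((y - x) / conj (y - x)) with hu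
  set d : ℂ := (x + y) / 2 + (y - x) / conj (y - x) * conj ((x + y) / 2) with hd
  have hR : ∀ z, bisectorReflection x y z = u * conj z + d := fun z => by
    rw [bisectorReflection_apply hxy, map_sub (starRingEnd ℂ) z, hu, hd]
    ring
  have hTfix : T = u * conj T + S.N * F.card * d := by
    calc T = ∑ i, ∑ v ∈ F, S.Ψ (σ i) v :=
          ((Finite.injective_iff_bijective.mp hσinj).sum_comp fun i => ∑ v ∈ F, S.Ψ i v).symm
      _ = ∑ i, ∑ v ∈ F, bisectorReflection x y (S.Ψ i v) := by
          refine Finset.sum_congr rfl fun i _ => ?_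
          refine (sum_eq_of_image_eq hfin ((bisectorReflection_injective x y).comp
            (S.Ψ_injective i)) (S.Ψ_injective (σ i)) ?_).symm
          rw [Set.image_comp, hσ]
      _ = u * conj T + S.N * F.card * d := by
          simp only [hR, Finset.sum_add_distrib, ← Finset.mul_sum, Finset.sum_const, nsmul_eq_mul,
            Finset.card_univ, Fintype.card_fin, hT, map_sum]
          ring
  rw [hR, map_div₀, map_mul, map_natCast, map_natCast]
  field_simp
  linear_combination -hTfix

/-- The reflections of the symmetry condition preserve the set of essential fixed points: the
image of this set is one of its translates, and both lie on the same circle. -/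
theorem bisectorReflection_mem (hK : S.IsSimpleNestedFractal K) (h3 : 3 ≤ S.k) {c : ℂ}
    (hc : ∀ x ∈ S.essential, ∀ y ∈ S.essential, x ≠ y → bisectorReflection x y c = c) :
    ∀ x ∈ S.essential, ∀ y ∈ S.essential, x ≠ y → ∀ z ∈ S.essential,
      bisectorReflection x y z ∈ S.essential := by
  intro x hx y hy hxy
  obtain ⟨i, -⟩ := hx.1
  obtain ⟨j, hj⟩ := hK.symmetry i x hx y hy hxy
  obtain ⟨τ, hτ⟩ : ∃ τ, ∀ z v, bisectorReflection x y (S.Ψ i z) = S.Ψ j v →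
      bisectorReflection x y z = v + τ := by
    refine ⟨bisectorReflection x y 0 + S.L * (S.ν j - bisectorReflection x y (S.ν i)),
      fun z v h => ?_⟩
    have hL := S.L_ne_zero
    have hLi := mul_inv_cancel₀ hL
    have e : bisectorReflection x y (S.Ψ i z) = (S.L : ℂ)⁻¹ * (bisectorReflection x y z -
        bisectorReflection x y 0) + bisectorReflection x y (S.ν i) := by
      simp only [bisectorReflection_apply hxy, Ψ_apply, map_sub, map_add, map_mul, map_inv₀,
        Complex.conj_ofReal, map_zero]
      ring
    rw [e, Ψ_apply] at h
    linear_combination S.L * h - (bisectorReflection x y z - bisectorReflection x y 0 - v) * hLi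
  have hτc : ∀ v ∈ S.essential, dist v (c - τ) = dist v c := by
    intro v hv
    obtain ⟨_, ⟨z, hz, rfl⟩, hzv⟩ : S.Ψ j v ∈ bisectorReflection x y '' (S.Ψ i '' S.essential) := by
      rw [hj]
      exact ⟨v, hv, rfl⟩
    rw [dist_eq_of_common_fixedPoint hc hv hz, ← dist_bisectorReflection x y z c, hτ z v hzv,
      hc x hx y hy hxy, dist_eq_norm, dist_eq_norm]
    congr 1
    ring
  have hτ0 : τ = 0 := by
    by_contra hne
    obtain ⟨p, hp, q, hq, r, hr, hpq, hpr, hqr⟩ := (Set.two_lt_ncard hK.finite_essential).mp h3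
    have hcc : c ≠ c - τ := fun h => hne (by linear_combination h)
    have hcirc : ∀ v ∈ S.essential, dist v c = dist p c := fun v hv =>
      dist_eq_of_common_fixedPoint hc hv hp
    have hcirc' : ∀ v ∈ S.essential, dist v (c - τ) = dist p c := fun v hv =>
      (hτc v hv).trans (hcirc v hv)
    rcases EuclideanGeometry.eq_of_dist_eq_of_dist_eq_of_finrank_eq_two
      Complex.finrank_real_complex hcc hpq (hcirc p hp) (hcirc q hq) (hcirc r hr)
      (hcirc' p hp) (hcirc' q hq) (hcirc' r hr) with h | h
    · exact hpr h.symm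
    · exact hqr h.symm
  intro z hz
  obtain ⟨v, hv, hzv⟩ : bisectorReflection x y (S.Ψ i z) ∈ S.Ψ j '' S.essential := by
    rw [← hj]
    exact ⟨_, ⟨z, hz, rfl⟩, rfl⟩
  rw [hτ z v hzv.symm, hτ0, add_zero]
  exact hv

/-- The essential fixed points are the vertices of a regular `k`-gon. -/
theorem essential_eq_range (hK : S.IsSimpleNestedFractal K) (h3 : 3 ≤ S.k) {ζ : ℂ}
    (hζ : IsPrimitiveRoot ζ S.k) :
    ∃ c w : ℂ, w ≠ 0 ∧ S.essential = Set.range fun a : ℕ => c + w * ζ ^ a := by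
  obtain ⟨c, hc⟩ := hK.exists_common_fixedPoint
  exact ⟨c, eq_range_of_bisectorReflection hK.finite_essential h3 hc
    (hK.bisectorReflection_mem h3 hc) hζ⟩

/-! ### Neighbouring cells -/

/-- Two different cells share at most one vertex. Two common vertices `Ψ i p ≠ Ψ i q` would make
`Ψ i (p + (q - p) / L)` a common point of the two cells which is not a vertex, because no vertex
lies strictly between two points of the circle through all vertices. -/
theorem shared_vertex_unique (hK : S.IsSimpleNestedFractal K) {c : ℂ} {ρ : ℝ}
    (hcirc : ∀ v ∈ S.essential, dist v c = ρ) {i j : Fin S.N} (hij : i ≠ j) {p p' q q' : ℂ}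
    (hp : p ∈ S.essential) (hp' : p' ∈ S.essential) (hq : q ∈ S.essential)
    (hq' : q' ∈ S.essential) (hpp' : S.Ψ i p = S.Ψ j p') (hqq' : S.Ψ i q = S.Ψ j q') : p = q := by
  by_contra hpq
  obtain ⟨a, ha⟩ := hp.1
  obtain ⟨a', ha'⟩ := hp'.1
  have hmaps : ∀ b, ∀ z ∈ K, S.Ψ b z ∈ K := fun b z hz => by
    rw [hK.isAttractor.eq_iUnion]
    exact Set.mem_iUnion.mpr ⟨b, z, hz, rfl⟩
  have hKess := essential_subset hK.isAttractor
  have hcommon : S.Ψ i (S.Ψ a q) = S.Ψ j (S.Ψ a' q') := by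
    simp only [Ψ_apply] at *
    linear_combination (S.L : ℂ)⁻¹ * (hqq' + ha - ha' - hpp') + hpp'
  have hmem : S.Ψ i (S.Ψ a q) ∈ S.Ψ i '' K ∩ S.Ψ j '' K :=
    ⟨⟨_, hmaps a q (hKess hq), rfl⟩, ⟨_, hmaps a' q' (hKess hq'), hcommon.symm⟩⟩
  rw [hK.nesting i j hij] at hmem
  obtain ⟨⟨v, hv, hvq⟩, -⟩ := hmem
  rw [S.Ψ_injective i hvq] at hv
  have hline : S.Ψ a q = AffineMap.lineMap p q S.L⁻¹ := by
    rw [AffineMap.lineMap_apply_module']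
    simp only [Ψ_apply, Complex.real_smul, Complex.ofReal_inv] at *
    linear_combination ha
  have hsbtw : Sbtw ℝ p (S.Ψ a q) q := by
    rw [hline, sbtw_lineMap_iff]
    exact ⟨hpq, inv_pos.mpr (zero_lt_one.trans S.one_lt_L), inv_lt_one_of_one_lt₀ S.one_lt_L⟩
  have hlt := hsbtw.dist_lt_max_dist c
  rw [hcirc _ hv, hcirc p hp, hcirc q hq, max_self] at hlt
  exact lt_irrefl _ hlt

/-- If the vertices form a centrally symmetric set, a common vertex of two cells is in antipodal
positions in them: with `Ψ i p = Ψ j p'` the cells also share `Ψ i (2c - p') = Ψ j (2c - p)`. -/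
theorem add_eq_of_shared_vertex (hK : S.IsSimpleNestedFractal K) {c : ℂ} {ρ : ℝ}
    (hcirc : ∀ v ∈ S.essential, dist v c = ρ) (hsymm : ∀ v ∈ S.essential, 2 * c - v ∈ S.essential)
    {i j : Fin S.N} (hij : i ≠ j) {p p' : ℂ} (hp : p ∈ S.essential) (hp' : p' ∈ S.essential)
    (hpp' : S.Ψ i p = S.Ψ j p') : p + p' = 2 * c := by
  have h := hK.shared_vertex_unique hcirc hij hp hp' (hsymm p' hp') (hsymm p hp) hpp' (by
    rw [Ψ_apply, Ψ_apply] at *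
    linear_combination hpp')
  linear_combination h

/-- By connectedness, an additive subgroup that contains the scaled difference of the translation
vectors of any two cells with a common vertex contains that of any two cells. -/
theorem ν_sub_ν_mem (hK : S.IsSimpleNestedFractal K) (Λ : AddSubgroup ℂ)
    (hΛ : ∀ i j, ∀ p ∈ S.essential, ∀ p' ∈ S.essential, S.Ψ i p = S.Ψ j p' →
      S.L * (S.ν i - S.ν j) ∈ Λ) (i j : Fin S.N) : S.L * (S.ν i - S.ν j) ∈ Λ := by
  have hcell : ∀ x : S.firstVertices, ∀ m, (x : ℂ) ∈ S.Ψ m '' K → (x : ℂ) ∈ S.Ψ m '' S.essential := by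
    intro x m hxm
    obtain ⟨b, hb⟩ := Set.mem_iUnion.mp x.2
    by_cases hbm : b = m
    · rwa [← hbm]
    · have hmem : (x : ℂ) ∈ S.Ψ b '' K ∩ S.Ψ m '' K :=
        ⟨Set.image_mono (essential_subset hK.isAttractor) hb, hxm⟩
      rw [hK.nesting b m hbm] at hmem
      exact hmem.2
  have hwalk : ∀ x y : S.firstVertices, (S.cellGraph K).Walk x y → ∀ i j,
      (x : ℂ) ∈ S.Ψ i '' S.essential → (y : ℂ) ∈ S.Ψ j '' S.essential →
        S.L * (S.ν i - S.ν j) ∈ Λ := by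
    intro x y W
    induction W with
    | nil =>
      rintro i j ⟨p, hp, hpx⟩ ⟨p', hp', hpx'⟩
      exact hΛ i j p hp p' hp' (hpx.trans hpx'.symm)
    | @cons x z y hxz W ih =>
      rintro i j ⟨p, hp, hpx⟩ hy
      obtain ⟨-, m, hxm, hzm⟩ := hxz
      obtain ⟨p', hp', hpx'⟩ := hcell x m hxm
      have h1 := hΛ i m p hp p' hp' (hpx.trans hpx'.symm)
      have h2 := ih m j (hcell z m hzm) hy
      convert Λ.add_mem h1 h2 using 1
      ring
  obtain ⟨v, hv⟩ := hK.nonempty_essential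
  have hfirst : ∀ b, S.Ψ b v ∈ S.firstVertices := fun b => Set.mem_iUnion.mpr ⟨b, v, hv, rfl⟩
  obtain ⟨W⟩ := hK.connected.preconnected ⟨_, hfirst i⟩ ⟨_, hfirst j⟩
  exact hwalk _ _ W i j ⟨v, hv, rfl⟩ ⟨v, hv, rfl⟩

end IsSimpleNestedFractal

end SimilitudeSystem

/-! ### Arithmetic of `2 ^ n`-th roots of unity -/

/-- An integer polynomial that vanishes at a root of unity of order `2 ^ (m + 1)` is divisible by
the cyclotomic polynomial `X ^ 2 ^ m + 1`. -/
theorem X_pow_add_one_dvd_of_aeval_eq_zero {m : ℕ} {ζ : ℂ}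
    (hζ : IsPrimitiveRoot ζ (2 ^ (m + 1))) {P : ℤ[X]} (hP : aeval ζ P = 0) :
    X ^ 2 ^ m + 1 ∣ P := by
  have hpos : 0 < 2 ^ (m + 1) := by positivity
  have h := minpoly.isIntegrallyClosed_dvd (hζ.isIntegral hpos) hP
  rw [← cyclotomic_eq_minpoly hζ hpos, cyclotomic_prime_pow_eq_geom_sum Nat.prime_two,
    Finset.sum_range_succ, Finset.sum_range_one, pow_zero, pow_one, add_comm] at h
  exact h

/-- The ring homomorphism `ℤ[ζ] → ℤ/2` with `ζ ↦ 1` is well defined. -/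
theorem two_dvd_eval_one {m : ℕ} {ζ : ℂ} (hζ : IsPrimitiveRoot ζ (2 ^ (m + 1))) {P : ℤ[X]}
    (hP : aeval ζ P = 0) : 2 ∣ P.eval 1 := by
  obtain ⟨Q, rfl⟩ := X_pow_add_one_dvd_of_aeval_eq_zero hζ hP
  exact ⟨Q.eval 1, by simp [one_add_one_eq_two]⟩

theorem dvd_of_X_pow_sub_one_dvd {R : Type*} [CommRing R] [Nontrivial R] {h d : ℕ} (hh : 0 < h)
    (hd : (X ^ h - 1 : R[X]) ∣ X ^ d - 1) : h ∣ d := by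
  have h1 : (X ^ h - 1 : R[X]) ∣ X ^ (h * (d / h)) - 1 := by
    rw [pow_mul]
    exact sub_one_dvd_pow_sub_one _ _
  have h2 : (X ^ h - 1 : R[X]) ∣ X ^ (d % h) - 1 := by
    have heq : (X ^ d - 1 : R[X]) = (X ^ (h * (d / h)) - 1) * X ^ (d % h) + (X ^ (d % h) - 1) := by
      conv_lhs => rw [← Nat.div_add_mod d h, pow_add]
      ring
    rw [heq] at hd
    exact (dvd_add_right (h1.mul_right _)).mp hd
  by_contra hnd
  have hr : d % h ≠ 0 := fun h0 => hnd (Nat.dvd_of_mod_eq_zero h0)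
  have hmonic : (X ^ h - 1 : R[X]).Monic := by
    simpa using monic_X_pow_sub_C (1 : R) hh.ne'
  have hmonic' : (X ^ (d % h) - 1 : R[X]).Monic := by
    simpa using monic_X_pow_sub_C (1 : R) hr
  refine hmonic.not_dvd_of_natDegree_lt hmonic'.ne_zero ?_ h2
  have e1 : (X ^ h - 1 : R[X]).natDegree = h := by
    simpa using natDegree_X_pow_sub_C (n := h) (r := (1 : R))
  have e2 : (X ^ (d % h) - 1 : R[X]).natDegree = d % h := by
    simpa using natDegree_X_pow_sub_C (n := d % h) (r := (1 : R))
  rw [e1, e2]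
  exact Nat.mod_lt _ hh

/-- Two powers of `ζ` that are congruent modulo `2` in `ℤ[ζ]` agree up to sign. -/
theorem two_pow_dvd_of_aeval_eq {m : ℕ} {ζ : ℂ} (hζ : IsPrimitiveRoot ζ (2 ^ (m + 1))) {P : ℤ[X]}
    {b d : ℕ} (hP : ζ ^ (b + d) - ζ ^ b = 2 * aeval ζ P) : 2 ^ m ∣ d := by
  have hζ0 : ζ ≠ 0 := hζ.ne_zero (by positivity)
  have h0 : aeval ζ (X ^ b * (X ^ d - 1) - 2 * P) = 0 := by
    simp only [map_sub, map_mul, map_pow, aeval_X, map_one, map_ofNat]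
    linear_combination hP
  have hdvd := X_pow_add_one_dvd_of_aeval_eq_zero hζ h0
  have h2 := Polynomial.map_dvd (Int.castRingHom (ZMod 2)) hdvd
  have hz : (2 : (ZMod 2)[X]) = 0 := by
    have : (2 : ZMod 2) = 0 := rfl
    rw [← map_ofNat C, this, map_zero]
  simp only [Polynomial.map_add, Polynomial.map_sub, Polynomial.map_mul, Polynomial.map_pow,
    map_X, Polynomial.map_one, Polynomial.map_ofNat, hz, zero_mul, sub_zero] at h2
  have hsign : (X ^ 2 ^ m + 1 : (ZMod 2)[X]) = X ^ 2 ^ m - 1 := by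
    linear_combination hz
  rw [hsign] at h2
  have hcop : IsCoprime (X ^ 2 ^ m - 1 : (ZMod 2)[X]) (X ^ b) := by
    apply IsCoprime.pow_right
    refine ⟨-1, X ^ (2 ^ m - 1), ?_⟩
    rw [← pow_succ, Nat.sub_add_cancel Nat.one_le_two_pow]
    ring
  exact dvd_of_X_pow_sub_one_dvd (by positivity) (hcop.dvd_of_dvd_mul_left h2)

theorem two_pow_mul_eq_of_two_dvd {m : ℕ} {x y : ℤ} (h : 2 ∣ x - y) :
    (2 ^ m * x : ZMod (2 ^ (m + 1))) = 2 ^ m * y := by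
  obtain ⟨z, hz⟩ := h
  have h0 : (2 ^ (m + 1) : ZMod (2 ^ (m + 1))) = 0 := by
    exact_mod_cast ZMod.natCast_self (2 ^ (m + 1))
  have hx : (x : ZMod (2 ^ (m + 1))) = y + 2 * z := by
    exact_mod_cast congrArg (Int.cast (R := ZMod (2 ^ (m + 1)))) (eq_add_of_sub_eq' hz)
  rw [hx]
  linear_combination (z : ZMod (2 ^ (m + 1))) * h0

/-- The element `a + 2 ^ m * P(1)` of `ℤ/2 ^ (m + 1)` depends only on the complex number
`ζ ^ a + 2 P(ζ)`. -/
theorem label_eq_of_aeval_eq {m : ℕ} {ζ : ℂ} (hζ : IsPrimitiveRoot ζ (2 ^ (m + 1))) {P Q : ℤ[X]}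
    {a b : ℕ} (h : ζ ^ a + 2 * aeval ζ P = ζ ^ b + 2 * aeval ζ Q) :
    (a + 2 ^ m * (P.eval 1 : ℤ) : ZMod (2 ^ (m + 1))) = b + 2 ^ m * (Q.eval 1 : ℤ) := by
  wlog hab : b ≤ a generalizing a b P Q
  · exact (this h.symm (le_of_not_ge hab)).symm
  obtain ⟨d, rfl⟩ := Nat.exists_eq_add_of_le hab
  obtain ⟨q, rfl⟩ := two_pow_dvd_of_aeval_eq (b := b) (d := d) hζ (P := Q - P) (by
    rw [map_sub]
    linear_combination h)
  have hhalf : ζ ^ 2 ^ m = -1 := by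
    have h0 : IsPrimitiveRoot (ζ ^ 2 ^ m) 2 := hζ.pow (by positivity) (pow_succ 2 m)
    exact h0.eq_neg_one_of_two_right
  have hsq : (2 ^ m * 2 : ZMod (2 ^ (m + 1))) = 0 := by
    rw [← pow_succ]
    exact_mod_cast ZMod.natCast_self (2 ^ (m + 1))
  -- `ζ ^ (b + 2 ^ m * q) = ± ζ ^ b` according to the parity of `q`
  have hpar : 2 ∣ (q : ℤ) + P.eval 1 - Q.eval 1 := by
    rcases Nat.even_or_odd' q with ⟨r, rfl | rfl⟩
    · have h1 : aeval ζ (P - Q) = 0 := by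
        rw [pow_add, pow_mul, hhalf, pow_mul, neg_one_sq, one_pow] at h
        rw [map_sub]
        linear_combination h / 2
      have h2 := two_dvd_eval_one hζ h1
      rw [eval_sub] at h2
      push_cast
      omega
    · have h1 : aeval ζ (X ^ b + Q - P) = 0 := by
        rw [pow_add, pow_mul, hhalf, pow_succ, pow_mul, neg_one_sq, one_pow] at h
        simp only [map_sub, map_add, map_pow, aeval_X]
        linear_combination (-1 / 2) * h
      have h2 := two_dvd_eval_one hζ h1
      simp only [eval_sub, eval_add, eval_pow, eval_X, one_pow] at h2
      push_cast
      omega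
  have h3 := two_pow_mul_eq_of_two_dvd (m := m) hpar
  push_cast at h3 ⊢
  linear_combination h3

namespace SimilitudeSystem

theorem pow_eq_pow_of_natCast_eq {k a b : ℕ} {ζ : ℂ} (hζ : IsPrimitiveRoot ζ k)
    (h : (a : ZMod k) = b) : ζ ^ a = ζ ^ b := by
  rw [ZMod.natCast_eq_natCast_iff, Nat.ModEq, hζ.eq_orderOf] at h
  rw [← pow_mod_orderOf ζ a, h, pow_mod_orderOf]

/-! ### The translation lattice -/

/-- The group `2 w ℤ[ζ]`, generated by the differences `2 w ζ ^ a` of antipodal vertices of the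
polygon with vertices `c + w ζ ^ a`. -/
noncomputable def diagonalLattice (w ζ : ℂ) : AddSubgroup ℂ :=
  ((AddMonoidHom.mulLeft (2 * w)).comp (aeval ζ : ℤ[X] →ₐ[ℤ] ℂ).toRingHom.toAddMonoidHom).range

theorem mem_diagonalLattice {w ζ t : ℂ} :
    t ∈ diagonalLattice w ζ ↔ ∃ P : ℤ[X], t = 2 * w * aeval ζ P := by
  simp only [diagonalLattice, AddMonoidHom.mem_range]
  exact exists_congr fun P => eq_comm

theorem two_mul_mul_pow_mem (w ζ : ℂ) (a : ℕ) : 2 * w * ζ ^ a ∈ diagonalLattice w ζ :=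
  mem_diagonalLattice.mpr ⟨X ^ a, by simp⟩

variable {S : SimilitudeSystem} {K : Set ℂ} {c w ζ : ℂ} {m : ℕ}

theorem pow_add_half (hζ : IsPrimitiveRoot ζ (2 ^ (m + 1))) (a : ℕ) :
    ζ ^ (a + 2 ^ m) = -ζ ^ a := by
  have h : IsPrimitiveRoot (ζ ^ 2 ^ m) 2 := hζ.pow (by positivity) (pow_succ 2 m)
  rw [pow_add, h.eq_neg_one_of_two_right, mul_neg_one]

theorem two_mul_sub_mem (hζ : IsPrimitiveRoot ζ (2 ^ (m + 1)))
    (hV : S.essential = Set.range fun a : ℕ => c + w * ζ ^ a) :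
    ∀ v ∈ S.essential, 2 * c - v ∈ S.essential := by
  rw [hV]
  rintro _ ⟨a, rfl⟩
  refine ⟨a + 2 ^ m, ?_⟩
  simp only [pow_add_half hζ]
  ring

/-- Differences of translation vectors of `0`-cells in `K^⟨1⟩` are in the lattice, since neighbouring
cells are translates of each other by a diagonal. -/
theorem IsSimpleNestedFractal.ν_sub_ν_mem_diagonalLattice (hK : S.IsSimpleNestedFractal K)
    (hζ : IsPrimitiveRoot ζ (2 ^ (m + 1)))
    (hV : S.essential = Set.range fun a : ℕ => c + w * ζ ^ a) (i j : Fin S.N) :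
    S.L * (S.ν i - S.ν j) ∈ diagonalLattice w ζ := by
  have hL := S.L_ne_zero
  have hcirc : ∀ v ∈ S.essential, dist v c = ‖w‖ := by
    rw [hV]
    rintro _ ⟨a, rfl⟩
    rw [dist_eq_norm, add_sub_cancel_left, norm_mul, norm_pow,
      hζ.norm'_eq_one (by positivity), one_pow, mul_one]
  refine hK.ν_sub_ν_mem _ (fun i j p hp p' hp' h => ?_) i j
  by_cases hij : i = j
  · rw [hij, sub_self, mul_zero]
    exact zero_mem _
  · have hadd := hK.add_eq_of_shared_vertex hcirc (two_mul_sub_mem hζ hV) hij hp hp' h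
    rw [hV] at hp'
    obtain ⟨a, rfl⟩ := hp'
    convert two_mul_mul_pow_mem w ζ a using 1
    rw [Ψ_apply, Ψ_apply] at h
    linear_combination S.L * h - hadd + (c + w * ζ ^ a - p) * mul_inv_cancel₀ hL

/-- The lattice is stable under multiplication by `L`, because `L (x - y) = x - y + L (ν i - ν j)`
for the fixed points `x` of `Ψ i` and `y` of `Ψ j`. -/
theorem IsSimpleNestedFractal.mul_mem_diagonalLattice (hK : S.IsSimpleNestedFractal K)
    (hζ : IsPrimitiveRoot ζ (2 ^ (m + 1)))
    (hV : S.essential = Set.range fun a : ℕ => c + w * ζ ^ a) {t : ℂ}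
    (ht : t ∈ diagonalLattice w ζ) : S.L * t ∈ diagonalLattice w ζ := by
  have hgen : ∀ a : ℕ, S.L * (2 * w * ζ ^ a) ∈ diagonalLattice w ζ := by
    intro a
    have hx : c + w * ζ ^ a ∈ S.essential := by rw [hV]; exact ⟨a, rfl⟩
    obtain ⟨i, hi⟩ := hx.1
    obtain ⟨j, hj⟩ := (two_mul_sub_mem hζ hV _ hx).1
    convert add_mem (two_mul_mul_pow_mem w ζ a) (hK.ν_sub_ν_mem_diagonalLattice hζ hV i j) using 1
    rw [Ψ_apply] at hi hj
    linear_combination S.L * (hj - hi) + 2 * w * ζ ^ a * mul_inv_cancel₀ S.L_ne_zero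
  obtain ⟨P, rfl⟩ := mem_diagonalLattice.mp ht
  rw [aeval_eq_sum_range, Finset.mul_sum, Finset.mul_sum]
  refine sum_mem fun a _ => ?_
  rw [mul_smul_comm, mul_smul_comm]
  exact zsmul_mem (hgen a) _

theorem IsSimpleNestedFractal.pow_mul_ν_mem (hK : S.IsSimpleNestedFractal K)
    (hζ : IsPrimitiveRoot ζ (2 ^ (m + 1)))
    (hV : S.essential = Set.range fun a : ℕ => c + w * ζ ^ a) (h0 : ∃ i, S.ν i = 0) (n : ℕ)
    (i : Fin S.N) : S.L ^ (n + 1) • S.ν i ∈ diagonalLattice w ζ := by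
  rw [Complex.real_smul, Complex.ofReal_pow]
  induction n with
  | zero =>
    obtain ⟨i₀, hi₀⟩ := h0
    simpa [hi₀] using hK.ν_sub_ν_mem_diagonalLattice hζ hV i i₀
  | succ n ih =>
    rw [pow_succ', mul_assoc]
    exact hK.mul_mem_diagonalLattice hζ hV ih

theorem IsSimpleNestedFractal.isOffset_mem (hK : S.IsSimpleNestedFractal K)
    (hζ : IsPrimitiveRoot ζ (2 ^ (m + 1)))
    (hV : S.essential = Set.range fun a : ℕ => c + w * ζ ^ a) (h0 : ∃ i, S.ν i = 0) {t : ℂ}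
    (ht : S.IsOffset 0 t) : t ∈ diagonalLattice w ζ := by
  obtain ⟨J, -, i, rfl⟩ := ht
  refine sum_mem fun j hj => ?_
  rw [Finset.mem_Icc] at hj
  obtain ⟨n, rfl⟩ : ∃ n : ℕ, j = ((n + 1 : ℕ) : ℤ) := ⟨(j - 1).toNat, by omega⟩
  rw [zpow_natCast]
  exact hK.pow_mul_ν_mem hζ hV h0 n _

/-! ### Vertices and barycenter of the unbounded fractal -/

theorem vertices_zero (S : SimilitudeSystem) : S.vertices 0 = S.essential := by
  simp [vertices]

theorem mem_unboundedVertices_zero {x : ℂ} :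
    x ∈ S.unboundedVertices 0 ↔ ∃ n, x ∈ S.zeroVertices n := by
  simp [unboundedVertices]

theorem vertices_subset_unboundedVertices (S : SimilitudeSystem) :
    S.vertices 0 ⊆ S.unboundedVertices 0 := fun _ hx =>
  mem_unboundedVertices_zero.mpr ⟨0, hx⟩

theorem add_offset_mem_unboundedVertices {v t : ℂ} (hv : v ∈ S.vertices 0) (ht : S.IsOffset 0 t) :
    v + t ∈ S.unboundedVertices 0 := by
  obtain ⟨J, hJ, i, rfl⟩ := ht
  lift J to ℕ using by omega
  refine mem_unboundedVertices_zero.mpr ⟨J, ?_⟩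
  clear hJ
  induction J with
  | zero => simpa [zeroVertices] using hv
  | succ n ih =>
    have hIcc : Finset.Icc (0 + 1 : ℤ) ((n + 1 : ℕ) : ℤ) =
        insert ((n + 1 : ℕ) : ℤ) (Finset.Icc (0 + 1 : ℤ) (n : ℤ)) := by
      ext j
      simp only [Finset.mem_insert, Finset.mem_Icc]
      omega
    rw [hIcc, Finset.sum_insert (by simp), zpow_natCast]
    exact Set.mem_iUnion.mpr ⟨i ((n + 1 : ℕ) : ℤ), _, ih, by ring⟩

/-- Every vertex of the unbounded fractal is a vertex of the central polygon moved by an element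
of the lattice. -/
theorem IsSimpleNestedFractal.exists_eq_of_mem_unboundedVertices (hK : S.IsSimpleNestedFractal K)
    (hζ : IsPrimitiveRoot ζ (2 ^ (m + 1)))
    (hV : S.essential = Set.range fun a : ℕ => c + w * ζ ^ a) (h0 : ∃ i, S.ν i = 0) {x : ℂ}
    (hx : x ∈ S.unboundedVertices 0) :
    ∃ (a : ℕ) (P : ℤ[X]), x = c + w * (ζ ^ a + 2 * aeval ζ P) := by
  obtain ⟨n, hn⟩ := mem_unboundedVertices_zero.mp hx
  clear hx
  induction n generalizing x with
  | zero =>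
    rw [zeroVertices, vertices_zero, hV] at hn
    obtain ⟨a, rfl⟩ := hn
    exact ⟨a, 0, by simp⟩
  | succ n ih =>
    obtain ⟨i, y, hy, rfl⟩ := Set.mem_iUnion.mp hn
    obtain ⟨a, P, rfl⟩ := ih hy
    obtain ⟨Q, hQ⟩ := mem_diagonalLattice.mp (hK.pow_mul_ν_mem hζ hV h0 n i)
    refine ⟨a, P + Q, ?_⟩
    simp only [hQ, map_add]
    ring

theorem barycenter_zero (hk : 2 ≤ S.k) (hζ : IsPrimitiveRoot ζ S.k) (hw : w ≠ 0)
    (hV : S.essential = Set.range fun a : ℕ => c + w * ζ ^ a) : S.barycenter 0 = c := by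
  have hinj : Set.InjOn (fun a : ℕ => c + w * ζ ^ a) (Finset.range S.k : Set ℕ) := by
    intro a ha b hb hab
    exact hζ.pow_inj (Finset.mem_range.mp ha) (Finset.mem_range.mp hb)
      (mul_left_cancel₀ hw (add_left_cancel hab))
  have himg : S.vertices 0 = (fun a : ℕ => c + w * ζ ^ a) '' (Finset.range S.k : Set ℕ) := by
    rw [vertices_zero, hV]
    refine Set.Subset.antisymm ?_ (Set.image_subset_range _ _)
    rintro _ ⟨a, rfl⟩
    refine ⟨a % S.k, Finset.mem_range.mpr (Nat.mod_lt _ (by omega)), ?_⟩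
    simp only [← pow_mod_orderOf ζ a, ← hζ.eq_orderOf]
  have hk0 : (S.k : ℂ) ≠ 0 := by
    exact_mod_cast (show S.k ≠ 0 by omega)
  rw [barycenter, himg, finsum_mem_image hinj, finsum_mem_coe_finset, Finset.sum_add_distrib,
    ← Finset.mul_sum, hζ.geom_sum_eq_zero (by omega)]
  simp [hk0]

end SimilitudeSystem

open SimilitudeSystem in
theorem theorem3 (S : SimilitudeSystem) (K : Set ℂ) (hK : S.IsSimpleNestedFractal K)
    (h0 : ∃ i, S.ν i = 0) (n : ℕ) (hn : 1 < n) (hk : S.k = 2 ^ n) :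
    S.HasGLP K := by
  obtain ⟨m, rfl⟩ : ∃ m, n = m + 1 := ⟨n - 1, by omega⟩
  have h4 : 4 ≤ S.k := by
    rw [hk]
    calc 4 = 2 ^ 2 := rfl
      _ ≤ 2 ^ (m + 1) := Nat.pow_le_pow_right two_pos hn
  obtain ⟨ζ, hζdef⟩ : ∃ ζ : ℂ, ζ = Complex.exp (2 * Real.pi * Complex.I / S.k) := ⟨_, rfl⟩
  have hζk : IsPrimitiveRoot ζ S.k := hζdef ▸ Complex.isPrimitiveRoot_exp S.k (by omega)
  obtain ⟨c, w, hw, hV⟩ := hK.essential_eq_range (by omega) hζk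
  have hbary := barycenter_zero (by omega) hζk hw hV
  have hζ : IsPrimitiveRoot ζ (2 ^ (m + 1)) := hk ▸ hζk
  obtain ⟨lab, hlab_eq⟩ : ∃ lab : S.unboundedVertices 0 → ZMod (2 ^ (m + 1)),
      ∀ (x : S.unboundedVertices 0) (b : ℕ) (Q : ℤ[X]),
        (x : ℂ) = c + w * (ζ ^ b + 2 * aeval ζ Q) → lab x = b + 2 ^ m * (Q.eval 1 : ℤ) := by
    choose a P haP using fun x : S.unboundedVertices 0 =>
      hK.exists_eq_of_mem_unboundedVertices hζ hV h0 x.2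
    refine ⟨fun x => a x + 2 ^ m * ((P x).eval 1 : ℤ), fun x b Q hx => ?_⟩
    rw [haP x] at hx
    exact label_eq_of_aeval_eq hζ (mul_left_cancel₀ hw (add_left_cancel hx))
  have hlab_vertex : ∀ (x : S.unboundedVertices 0) (b : ℕ), (x : ℂ) = c + w * ζ ^ b →
      lab x = b := by
    intro x b hx
    simpa using hlab_eq x b 0 (by simpa using hx)
  obtain ⟨e⟩ : Nonempty (ZMod (2 ^ (m + 1)) ≃ Fin S.k) :=
    ⟨(ZMod.finEquiv (2 ^ (m + 1))).symm.toEquiv.trans (finCongr hk.symm)⟩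
  refine ⟨0, fun x => e (lab x), ⟨fun _ _ => Set.mem_univ _, ?_, ?_⟩, ?_⟩
  · intro x hx y hy hxy
    rw [Set.mem_ofPred_eq, vertices_zero, hV] at hx hy
    obtain ⟨b, hb⟩ := hx
    obtain ⟨d, hd⟩ := hy
    have h := e.injective hxy
    rw [hlab_vertex x b hb.symm, hlab_vertex y d hd.symm] at h
    have hxy' : c + w * ζ ^ b = c + w * ζ ^ d := by rw [pow_eq_pow_of_natCast_eq hζ h]
    exact Subtype.ext (hb.symm.trans (hxy'.trans hd))
  · intro s _
    obtain ⟨b, hb⟩ := ZMod.natCast_zmod_surjective (e.symm s)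
    have hmem : c + w * ζ ^ b ∈ S.vertices 0 := by
      rw [vertices_zero, hV]
      exact ⟨b, rfl⟩
    refine ⟨⟨_, vertices_subset_unboundedVertices S hmem⟩, hmem, ?_⟩
    exact (congrArg e ((hlab_vertex _ b rfl).trans hb)).trans (e.apply_symm_apply s)
  · rintro Δ t ⟨-, ht, -⟩
    obtain ⟨Q, hQ⟩ := mem_diagonalLattice.mp (hK.isOffset_mem hζ hV h0 ht)
    -- The labelling of the complex is rotated by `k / 2` exactly if `Q(1)` is odd.
    obtain ⟨r, hr, hrQ⟩ : ∃ r ∈ Finset.Icc 1 S.k,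
        (r : ZMod (2 ^ (m + 1))) = 2 ^ m * (Q.eval 1 : ℤ) := by
      have hpos : 1 ≤ 2 ^ m := Nat.one_le_two_pow
      have hdouble : 2 ^ (m + 1) = 2 ^ m * 2 := pow_succ 2 m
      rcases Int.even_or_odd (Q.eval 1) with hev | hodd
      · refine ⟨S.k, Finset.mem_Icc.mpr ⟨by omega, le_rfl⟩, ?_⟩
        rw [two_pow_mul_eq_of_two_dvd (y := 0) (by simpa using hev.two_dvd), hk,
          ZMod.natCast_self]
        simp
      · refine ⟨2 ^ m, Finset.mem_Icc.mpr ⟨by omega, by omega⟩, ?_⟩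
        rw [two_pow_mul_eq_of_two_dvd (y := 1) (hodd.sub_odd odd_one).two_dvd]
        simp
    refine ⟨r, hr, ?_⟩
    rintro _ ⟨v, hv, rfl⟩
    have hv' := hv
    rw [vertices_zero, hV] at hv'
    obtain ⟨b, rfl⟩ := hv'
    have hrot : S.rotation 0 r (c + w * ζ ^ b + t - t) = c + w * ζ ^ (b + r) := by
      have hexp : Complex.exp (2 * Real.pi * Complex.I * (r / S.k)) = ζ ^ r := by
        rw [hζdef, ← Complex.exp_nat_mul]
        congr 1
        ring
      rw [SimilitudeSystem.rotation, hbary, hexp, pow_add]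
      ring
    have hmem : S.rotation 0 r (c + w * ζ ^ b + t - t) ∈ S.vertices 0 := by
      rw [hrot, vertices_zero, hV]
      exact ⟨_, rfl⟩
    refine ⟨add_offset_mem_unboundedVertices hv ht, vertices_subset_unboundedVertices S hmem, ?_⟩
    refine congrArg e ?_
    refine (hlab_eq _ b Q (by simp only [hQ]; ring)).trans ?_
    rw [← hrQ, ← Nat.cast_add]
    exact (hlab_vertex _ (b + r) hrot).symm
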